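/- **Model.** A multiple access channel has $n$ stations, named $0,\dots,n-1$, and works in synchronous rounds $0,1,2,\dots$. In each round each station is switched on or off. If exactly one switched-on station transmits a message in a round, then all switched-on stations hear it; otherwise nothing is heard. A message consists of at most one packet and a string of control bits. A packet has a destination station. It is delivered in a round if it is heard in that round while its destination is switched on, and then it leaves the system. Packets are injected into arbitrary stations, switched on or off, and are stored in the queues of these stations. An adversary of type $(\rho,\beta)$, where $0<\rho\le 1$ and $\beta\ge 1$ are real numbers, may inject at most $\rho t+\beta$ packets in each interval of $t$ consecutive rounds. A deterministic distributed algorithm is *$k$-energy-oblivious* if it is fixed in advance, independently of the injections, which stations are switched on in which round, and at most $k$ of them are switched on in each round. It *routes directly* if each packet heard on the channel is delivered in that round by the station into which it was injected, with no relay stations. It is *stable* against adversaries of injection rate $\rho$ if for each $\beta\ge1$ the number of queued packets is bounded over all rounds of all its executions against adversaries of type $(\rho,\beta)$. **Algorithm $k$-Subsets.** Let $2\le k<n$ and $\gamma=\binom nk$, and let $A_0,\dots,A_{\gamma-1}$ be any enumeration of the $k$-element sets of stations. The rounds congruent to $i$ modulo $\gamma$ form thread $i$, and the stations switched on in them are those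 in $A_i$. The rounds $j\gamma,\dots,(j+1)\gamma-1$ form phase $j$. Each station $v$ has a separate queue for each thread. At the beginning of each phase, $v$ allocates the packets that were injected into it in the previous phase to threads, where a packet addressed to $w$ may be allocated only to a thread $i$ with $v,w\in A_i$; for each $w$, the numbers $x_i(w)$ of packets addressed to $w$ that $v$ has allocated so far to thread $i$, for those $i$ with $v,w\in A_i$, always differ from each other by at most $1$. (The rule for the allocation is otherwise arbitrary, and so is the order in which packets are taken from a queue.) In the rounds of thread $i$ the stations of $A_i$ run Move-Big-To-Front with their queues of thread $i$: every station of $A_i$ keeps a copy of a list of the stations of $A_i$, initially ordered by names, and a token is initially at the first station of the list. In each round of the thread the holder of the token transmits a packet from its queue of the thread, if there is one, together with a control bit that tells whether it is big, i.e. whether this queue has at least $k$ packets at that time. If the packet is heard, then it leaves the queue. If the holder announced that it is big, then it is moved to the front of the list and keeps the token; otherwise (in a silent round too) the token passes to the next station in the cyclic order of the list. **Theorem ($k$-Subsets).** For all integers $2\le k<n$, algorithm $k$-Subsets is $k$-energy-oblivious, routes directly, and is stable against adversaries of injection rate $\frac{k(k-1)}{n(n-1)}$. Moreover, in each execution against an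 adversary of type $\left(\frac{k(k-1)}{n(n-1)},\beta\right)$, the number of queued packets is at most $2\binom nk(n^2+\beta)$ in every round. -/

import Mathlib

universe u

/-! ## Multiple access channels with on/off stations -/

/-- A packet: the name of its destination station and its content. -/
structure Packet (n : ℕ) (C : Type u) where
  dest : Fin n
  content : C

/-- A message: at most one packet and a string of control bits. -/
structure Message (n : ℕ) (C : Type u) where
  packet : Option (Packet n C)
  control : List Bool

/-- A deterministic distributed algorithm for `n` stations. All stations start in round `0` and so
know the number of the current round. What a station does depends only on its name, the round and
its private state. -/
structure RoutingAlgorithm (n : ℕ) (C : Type u) where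
  State : Type u
  init : Fin n → State
  /-- is the station switched on in this round? -/
  isOn : Fin n → ℕ → State → Prop
  /-- the message that the station transmits in this round, when it is switched on -/
  transmit : Fin n → ℕ → State → Option (Message n C)
  /-- the new state, from the message heard in the round (`none` if nothing was heard) and the list
  of the packets injected into the station in the round -/
  step : Fin n → ℕ → State → Option (Message n C) → List (Packet n C) → State
  /-- the packets stored in the station -/
  queue : State → List (Packet n C)

/-- What an adversary injects: for each round and each station a list of packets. -/
abbrev Injection (n : ℕ) (C : Type u) := ℕ → Fin n → List (Packet n C)

/-- The injection is by an adversary of type `(ρ, β)` (leaky bucket): at most `ρ * t + β` packets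
in each interval of `t` consecutive rounds. -/
def Injection.OfType {n : ℕ} {C : Type u} (inj : Injection n C) (ρ β : ℝ) : Prop :=
  0 < ρ ∧ ρ ≤ 1 ∧ 1 ≤ β ∧
    ∀ s t : ℕ, ((∑ r ∈ Finset.Ico s (s + t), ∑ v, (inj r v).length : ℕ) : ℝ) ≤ ρ * t + β

namespace RoutingAlgorithm

variable {n : ℕ} {C : Type u} (alg : RoutingAlgorithm n C)

/-- The stations that are switched on in round `t`, if the states are `σ`. -/
noncomputable def onStations (t : ℕ) (σ : Fin n → alg.State) : Finset (Fin n) :=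
  open Classical in Finset.univ.filter fun v => alg.isOn v t (σ v)

/-- In round `t`, with states `σ`, the station `v` transmits the message `m` and no other station
transmits, so that `m` is heard by all the stations that are switched on. -/
def HeardFrom (t : ℕ) (σ : Fin n → alg.State) (v : Fin n) (m : Message n C) : Prop :=
  v ∈ alg.onStations t σ ∧ alg.transmit v t (σ v) = some m ∧
    ∀ u ∈ alg.onStations t σ, u ≠ v → alg.transmit u t (σ u) = none

/-- The message heard on the channel, `none` in a silent round and in case of a collision. -/
noncomputable def heard (t : ℕ) (σ : Fin n → alg.State) : Option (Message n C) :=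
  open Classical in
  if h : ∃ m v, alg.HeardFrom t σ v m then some h.choose else none

/-- The feedback from the channel at station `v`: a station that is switched off hears nothing. -/
noncomputable def feedback (t : ℕ) (σ : Fin n → alg.State) (v : Fin n) : Option (Message n C) :=
  open Classical in if v ∈ alg.onStations t σ then alg.heard t σ else none

/-- The states of the stations at the beginning of each round of the execution. -/
noncomputable def exec (inj : Injection n C) : ℕ → Fin n → alg.State
  | 0 => alg.init
  | t + 1 => fun v =>
      alg.step v t (exec inj t v) (alg.feedback t (exec inj t) v) (inj t v)

/-- The number of packets queued in round `t`, the ones injected in round `t` included. -/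
noncomputable def queueSize (inj : Injection n C) (t : ℕ) : ℕ :=
  ∑ v, ((alg.queue (alg.exec inj t v)).length + (inj t v).length)

/-- It is determined before the execution, independently of the injections, which stations are
switched on in which round, and there are at most `k` of them in a round. -/
def EnergyOblivious (k : ℕ) : Prop :=
  ∃ S : ℕ → Finset (Fin n), (∀ t, (S t).card ≤ k) ∧
    ∀ (inj : Injection n C) (t : ℕ), alg.onStations t (alg.exec inj t) = S t

/-- Packets make only one hop: each packet heard on the channel is delivered in that round, as
its destination is switched on, it then leaves the queue of the transmitting station, and in no
other way are queues changed than by such deliveries and by the injections. -/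
def RoutesDirectly : Prop :=
  ∀ (inj : Injection n C) (t : ℕ) (v : Fin n),
    (∀ m p, alg.HeardFrom t (alg.exec inj t) v m → m.packet = some p →
      p.dest ∈ alg.onStations t (alg.exec inj t) ∧
      p ∈ alg.queue (alg.exec inj t v) ∧
      (p ::ₘ (alg.queue (alg.exec inj (t + 1) v) : Multiset (Packet n C))) =
        (alg.queue (alg.exec inj t v) : Multiset (Packet n C)) + (inj t v : Multiset _)) ∧
    ((¬ ∃ m p, alg.HeardFrom t (alg.exec inj t) v m ∧ m.packet = some p) →
      (alg.queue (alg.exec inj (t + 1) v) : Multiset (Packet n C)) =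
        (alg.queue (alg.exec inj t v) : Multiset (Packet n C)) + (inj t v : Multiset _))

/-- Stability against the adversaries of injection rate `ρ`: for each burstiness coefficient, the
queue sizes are bounded. -/
def Stable (ρ : ℝ) : Prop :=
  ∀ β : ℝ, 1 ≤ β → ∃ B : ℝ, ∀ inj : Injection n C, inj.OfType ρ β →
    ∀ t, (alg.queueSize inj t : ℝ) ≤ B

end RoutingAlgorithm

/-! ## Move-Big-To-Front: the list of stations and the token -/

/-- A list of stations, and the position in it of the station that holds the token. -/
structure TokenList (n : ℕ) where
  order : List (Fin n)
  pos : ℕ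

namespace TokenList

variable {n : ℕ}

/-- The stations in the order of their names, with the token at the first one. -/
def start (S : Finset (Fin n)) : TokenList n := ⟨S.sort (· ≤ ·), 0⟩

/-- The station that holds the token. -/
def holder (L : TokenList n) : Option (Fin n) := L.order[L.pos]?

/-- The list after a round. If the holder announced that it is big then it is moved to the front
and keeps the token, otherwise the token passes to the next station in the cyclic order. -/
def next (L : TokenList n) (big : Bool) : TokenList n :=
  match big, L.holder with
  | true, some h => ⟨h :: L.order.erase h, 0⟩
  | _, _ => ⟨L.order, (L.pos + 1) % L.order.length⟩

end TokenList

/-! ## The algorithm k-Subsets -/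

/-- Threads are numbered `0, …, (n choose k) - 1`. -/
abbrev Thread (n k : ℕ) := Fin (n.choose k)

/-- The thread of a round. -/
def threadOf {n k : ℕ} (hkn : k < n) (t : ℕ) : Thread n k :=
  ⟨t % n.choose k, Nat.mod_lt _ (Nat.choose_pos hkn.le)⟩

/-- The choices that k-Subsets leaves open: an enumeration of the `k`-element sets of stations, a
rule for a balanced allocation of packets to threads, and the order in which packets are taken from
a queue. -/
structure SubsetsRules (n k : ℕ) (C : Type u) where
  /-- the enumeration of the `k`-element sets of stations -/
  A : Thread n k ≃ {S : Finset (Fin n) // S.card = k}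
  /-- the thread to which station `v` allocates each of the packets `ps` addressed to `w`, if it has
  so far allocated `x i` packets addressed to `w` to thread `i`, for each `i` -/
  place : (v w : Fin n) → (x : Thread n k → ℕ) → (ps : List (Packet n C)) →
    Fin ps.length → Thread n k
  /-- both `v` and `w` are active in the chosen thread -/
  place_mem : ∀ v w x ps a, v ∈ (A (place v w x ps a)).1 ∧ w ∈ (A (place v w x ps a)).1
  /-- the numbers of packets allocated to the threads in which both `v` and `w` are active keep
  differing by at most one -/
  place_balanced : ∀ v w x ps,
    (∀ i j, v ∈ (A i).1 → w ∈ (A i).1 → v ∈ (A j).1 → w ∈ (A j).1 → x i ≤ x j + 1) →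
    ∀ i j, v ∈ (A i).1 → w ∈ (A i).1 → v ∈ (A j).1 → w ∈ (A j).1 →
      x i + (Finset.univ.filter fun a => place v w x ps a = i).card ≤
        x j + (Finset.univ.filter fun a => place v w x ps a = j).card + 1
  /-- the position of the packet that a station takes from its nonempty queue of a thread -/
  pick : Fin n → Thread n k → List (Packet n C) → ℕ
  pick_lt : ∀ v i q, q ≠ [] → pick v i q < q.length

/-- The private state of a station. -/
structure SubsetsState (n k : ℕ) (C : Type u) where
  /-- packets received in the current phase, not yet allocated -/
  fresh : List (Packet n C)
  /-- for each `w` and `i`, the number of packets addressed to `w` allocated so far to thread `i` -/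
  count : Fin n → Thread n k → ℕ
  /-- the dedicated queue of each thread -/
  threadQueue : Thread n k → List (Packet n C)
  /-- the private copy of the list and the token of each thread -/
  tokenList : Thread n k → TokenList n

namespace SubsetsRules

variable {n k : ℕ} {C : Type u} (R : SubsetsRules n k C)

/-- The packets addressed to `w` among the fresh packets of a station. -/
def freshTo (s : SubsetsState n k C) (w : Fin n) : List (Packet n C) :=
  s.fresh.filter fun p => p.dest = w

/-- The fresh packets addressed to `w` that `v` allocates to thread `i`. -/
def allotted (v : Fin n) (s : SubsetsState n k C) (w : Fin n) (i : Thread n k) :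
    List (Packet n C) :=
  ((List.finRange (freshTo s w).length).filter fun a =>
    R.place v w (s.count w) (freshTo s w) a = i).map (freshTo s w).get

/-- The allocation of all the fresh packets of station `v` to threads. -/
def allocate (v : Fin n) (s : SubsetsState n k C) : SubsetsState n k C where
  fresh := []
  count := fun w i => s.count w i + (R.allotted v s w i).length
  threadQueue := fun i =>
    s.threadQueue i ++ (List.finRange n).flatMap fun w => R.allotted v s w i
  tokenList := s.tokenList

/-- The message of station `v` in a round of thread `i`: the holder of the token transmits a packet
from its queue of the thread, if there is one, with a control bit that tells whether it is big, that
is, whether this queue has at least `k` packets, `k` being the number of stations of the thread. -/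
def message (v : Fin n) (i : Thread n k) (s : SubsetsState n k C) : Option (Message n C) :=
  if (s.tokenList i).holder = some v then
    (s.threadQueue i)[R.pick v i (s.threadQueue i)]?.map fun p =>
      ⟨some p, [decide (k ≤ (s.threadQueue i).length)]⟩
  else none

/-- The update of station `v` by what it hears in a round of thread `i` in which it is active. The
holder of the token removes its transmitted packet, and the list of the thread is updated. -/
def afterRound (v : Fin n) (i : Thread n k) (s : SubsetsState n k C)
    (fb : Option (Message n C)) : SubsetsState n k C where
  fresh := s.fresh
  count := s.count
  threadQueue :=
    if (s.tokenList i).holder = some v ∧ fb.isSome then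
      Function.update s.threadQueue i
        ((s.threadQueue i).eraseIdx (R.pick v i (s.threadQueue i)))
    else s.threadQueue
  tokenList :=
    Function.update s.tokenList i
      ((s.tokenList i).next (decide (fb.map Message.control = some [true])))

end SubsetsRules

/-- The algorithm k-Subsets. The phases are the intervals of `n.choose k` rounds that begin at
multiples of `n.choose k`; the packets injected in a phase are allocated to threads between this
phase and the next one. -/
def kSubsets {n k : ℕ} {C : Type u} (hkn : k < n) (R : SubsetsRules n k C) :
    RoutingAlgorithm n C where
  State := SubsetsState n k C
  init := fun _ => ⟨[], fun _ _ => 0, fun _ => [], fun i => TokenList.start (R.A i).1⟩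
  isOn := fun v t _ => v ∈ (R.A (threadOf hkn t)).1
  transmit := fun v t s => R.message v (threadOf hkn t) s
  step := fun v t s fb new =>
    let s₁ := if v ∈ (R.A (threadOf hkn t)).1 then R.afterRound v (threadOf hkn t) s fb else s
    let s₂ : SubsetsState n k C := { s₁ with fresh := s₁.fresh ++ new }
    if n.choose k ∣ t + 1 then R.allocate v s₂ else s₂
  queue := fun s => s.fresh ++ (List.finRange (n.choose k)).flatMap s.threadQueue

/-! Write $\gamma=\binom nk$, $m=\binom{n-2}{k-2}$ and $\rho=\frac{k(k-1)}{n(n-1)}$. Each thread has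
one round per phase, and $\gamma\rho=m$ (`choose_mul_rate`). So the adversary injects about $m$
packets per phase, while every pair $(v,w)$ has at least $m$ common threads
(`choose_le_card_commonThreads`). Even if all packets go from one $v$ to one $w$, balanced
allocation gives each thread about one packet per round of the thread, the most it can carry.

One thread: Move-Big-To-Front loses only a bounded number of rounds. A potential dominating the
queue sizes drops by one per round, apart from arrivals, unless the token passes from the last
station of the list to the first. At such a wrap no station was big when the token last left it, so
the potential is small again. Hence at phase $j$ the thread holds at most $k^2$ packets plus what it
received since some earlier phase $s$, minus $j-s$ (`MoveBigToFrontRun.exists_sum_le`).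

All threads: the phases $s_i$ differ from thread to thread, so the adversary's constraint on a
single interval is not enough. For a pair $(v,w)$, balance lets the increase of each counter be
replaced by the average increase over the common threads in the same period, at a cost of one
(`sum_increase_le_of_balanced`). Summing over the pairs in $A_i$ bounds the share of thread $i$ by
$1/m$ of all packets injected since phase $s_i$, plus $k^2$, hence by $(j-s_i)+\beta+k^2$
(`sum_received_le`). The terms $j-s_i$ cancel, leaving $\gamma(2k^2+\beta)$ packets at the beginning
of a phase; those injected in the current phase are added in `queueSize_le_bound`. -/

/-! ### The potential of a token list. -/

theorem List.idxOf_cons_erase {α : Type*} [DecidableEq α] {l : List α} {a v : α} (hv : v ∈ l)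
    (hne : v ≠ a) :
    (a :: l.erase a).idxOf v = l.idxOf v + (if l.idxOf v < l.idxOf a then 1 else 0) := by
  rw [List.idxOf_cons_ne _ hne.symm]
  induction l with
  | nil => simp at hv
  | cons b l ih =>
    by_cases hba : b = a
    · subst hba
      simp [List.idxOf_cons_ne _ hne.symm]
    · rw [List.erase_cons_tail (by simpa using hba), List.idxOf_cons_ne _ hba]
      by_cases hbv : b = v
      · subst hbv
        simp
      · rw [List.idxOf_cons_ne _ hbv, List.idxOf_cons_ne _ hbv]
        have := ih (by simpa [Ne.symm hbv] using hv)
        simp only [Nat.succ_eq_add_one, Nat.add_lt_add_iff_right] at this ⊢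
        omega

namespace TokenList

variable {n : ℕ}

/-- The list consists of the stations of `S`, without repetitions, and the token is in it. -/
structure IsOver (L : TokenList n) (S : Finset (Fin n)) : Prop where
  nodup : L.order.Nodup
  mem_iff : ∀ v, v ∈ L.order ↔ v ∈ S
  pos_lt : L.pos < L.order.length

variable {L : TokenList n} {S : Finset (Fin n)}

theorem IsOver.length_eq (hL : L.IsOver S) : L.order.length = S.card := by
  rw [← List.toFinset_card_of_nodup hL.nodup]
  congr 1
  ext v
  simp [hL.mem_iff]

theorem IsOver.start (hS : S.Nonempty) : (start S).IsOver S where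
  nodup := Finset.sort_nodup _ _
  mem_iff := by simp [TokenList.start]
  pos_lt := by simpa [TokenList.start] using hS.card_pos

theorem IsOver.exists_holder (hL : L.IsOver S) :
    ∃ h ∈ S, L.holder = some h ∧ L.order.idxOf h = L.pos := by
  refine ⟨L.order[L.pos]'hL.pos_lt, ?_, ?_, ?_⟩
  · rw [← hL.mem_iff]
    exact List.getElem_mem _
  · simp [holder, hL.pos_lt]
  · exact List.Nodup.idxOf_getElem hL.nodup _ _

theorem next_true {h : Fin n} (hh : L.holder = some h) :
    L.next true = ⟨h :: L.order.erase h, 0⟩ := by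
  simp [next, hh]

theorem next_false : L.next false = ⟨L.order, (L.pos + 1) % L.order.length⟩ := by
  simp [next]

theorem IsOver.next (hL : L.IsOver S) (b : Bool) : (L.next b).IsOver S := by
  obtain ⟨h, hS, hh, -⟩ := hL.exists_holder
  cases b with
  | false =>
    rw [next_false]
    exact ⟨hL.nodup, hL.mem_iff, Nat.mod_lt _ (by have := hL.pos_lt; omega)⟩
  | true =>
    rw [next_true hh]
    refine ⟨List.nodup_cons.2 ⟨hL.nodup.not_mem_erase, hL.nodup.erase _⟩, fun v => ?_, by simp⟩
    rw [List.mem_cons, hL.nodup.mem_erase_iff, hL.mem_iff]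
    by_cases hv : v = h
    · simp [hv, hS]
    · simp [hv]

/-- The position of a station, moved back by one if the token has already passed the station: its
position when the next big station will have been moved to the front. -/
def rank (L : TokenList n) (v : Fin n) : ℕ :=
  L.order.idxOf v + if L.order.idxOf v < L.pos then 1 else 0

/-- The number of packets in the queues of the stations of `S`, plus a bound on the number of silent
rounds while there is always a big station. -/
def weight (L : TokenList n) (S : Finset (Fin n)) (q : Fin n → ℕ) : ℕ :=
  ∑ v ∈ S, max (q v) (S.card - 1 - L.rank v)

theorem sum_le_weight (q : Fin n → ℕ) : ∑ v ∈ S, q v ≤ L.weight S q :=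
  Finset.sum_le_sum fun _ _ => le_max_left _ _

theorem weight_le_of_arrivals {q q' a : Fin n → ℕ} (h : ∀ v ∈ S, q' v ≤ q v + a v) :
    L.weight S q' ≤ L.weight S q + ∑ v ∈ S, a v := by
  rw [weight, weight, ← Finset.sum_add_distrib]
  exact Finset.sum_le_sum fun v hv => by have := h v hv; omega

/-- Moving the holder to the front leaves the rank of every other station unchanged, by the choice
of `rank`. The term of the holder equals its queue size before the round, and the remaining $|S|-1$
or more packets still dominate the other entry of the maximum. -/
theorem IsOver.weight_next_big (hL : L.IsOver S) {q : Fin n → ℕ} {h : Fin n}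
    (hh : L.holder = some h) (hbig : S.card ≤ q h) (hS : 0 < S.card) :
    (L.next true).weight S (Function.update q h (q h - 1)) + 1 ≤ L.weight S q := by
  obtain ⟨h', hmem, hh', hidx⟩ := hL.exists_holder
  obtain rfl : h' = h := by simpa [hh'] using hh
  rw [weight, weight, ← Finset.add_sum_erase _ _ hmem, ← Finset.add_sum_erase _ _ hmem]
  have h1 : ∑ v ∈ S.erase h', max (Function.update q h' (q h' - 1) v)
        (S.card - 1 - (L.next true).rank v) =
      ∑ v ∈ S.erase h', max (q v) (S.card - 1 - L.rank v) := by
    refine Finset.sum_congr rfl fun v hv => ?_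
    obtain ⟨hne, hv⟩ := Finset.mem_erase.1 hv
    rw [Function.update_of_ne hne, next_true hh, rank, rank,
      List.idxOf_cons_erase ((hL.mem_iff v).2 hv) hne, hidx]
    simp
  rw [h1, Function.update_self]
  omega

/-- Only the holder changes rank, from `pos` to `pos + 1`. Its queue (unless empty) and its positive
rank term both drop by one, so a silent round also lowers the potential. -/
theorem IsOver.weight_next_small (hL : L.IsOver S) {q : Fin n → ℕ} {h : Fin n}
    (hh : L.holder = some h) (hpos : L.pos + 1 < S.card) :
    (L.next false).weight S (Function.update q h (q h - 1)) + 1 ≤ L.weight S q := by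
  obtain ⟨h', hmem, hh', hidx⟩ := hL.exists_holder
  obtain rfl : h' = h := by simpa [hh'] using hh
  rw [weight, weight, ← Finset.add_sum_erase _ _ hmem, ← Finset.add_sum_erase _ _ hmem]
  have hnext : L.next false = ⟨L.order, L.pos + 1⟩ := by
    rw [next_false, Nat.mod_eq_of_lt (by rwa [hL.length_eq])]
  have h1 : ∑ v ∈ S.erase h', max (Function.update q h' (q h' - 1) v)
        (S.card - 1 - (L.next false).rank v) =
      ∑ v ∈ S.erase h', max (q v) (S.card - 1 - L.rank v) := by
    refine Finset.sum_congr rfl fun v hv => ?_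
    obtain ⟨hne, hv⟩ := Finset.mem_erase.1 hv
    have hvpos : L.order.idxOf v ≠ L.pos := fun he => hne
      ((List.idxOf_inj ((hL.mem_iff v).2 hv)).1 (he.trans hidx.symm))
    rw [Function.update_of_ne hne, hnext, rank, rank]
    have : L.order.idxOf v < L.pos + 1 ↔ L.order.idxOf v < L.pos := by omega
    simp [this]
  have h2 : L.rank h' = L.pos := by simp [rank, hidx]
  have h3 : (L.next false).rank h' = L.pos + 1 := by simp [hnext, rank, hidx]
  rw [h1, Function.update_self, h2, h3]
  omega

end TokenList

/-! ### Move-Big-To-Front in a single thread. -/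

/-- An execution of Move-Big-To-Front by the stations of `S`: in the `j`th round the token list is
`L j`, the queue sizes are `q j`, and `x j` counts the packets received so far. -/
structure MoveBigToFrontRun {n : ℕ} (S : Finset (Fin n)) (L : ℕ → TokenList n)
    (q x : ℕ → Fin n → ℕ) : Prop where
  start : L 0 = TokenList.start S
  empty : ∀ v ∈ S, q 0 v = 0
  mono : ∀ v ∈ S, Monotone fun j => x j v
  next : ∀ j h, (L j).holder = some h → L (j + 1) = (L j).next (decide (S.card ≤ q j h))
  queue : ∀ j h, (L j).holder = some h → ∀ v ∈ S,
    q (j + 1) v + x j v = Function.update (q j) h (q j h - 1) v + x (j + 1) v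

namespace MoveBigToFrontRun

variable {n : ℕ} {S : Finset (Fin n)} {L : ℕ → TokenList n} {q x : ℕ → Fin n → ℕ}

theorem isOver (H : MoveBigToFrontRun S L q x) (hS : S.Nonempty) (j : ℕ) : (L j).IsOver S := by
  induction j with
  | zero => exact H.start ▸ .start hS
  | succ j ih =>
    obtain ⟨h, -, hh, -⟩ := ih.exists_holder
    exact H.next j h hh ▸ ih.next _

/-- The stations that the token has passed since it was last at the front of the list were not big
when it left them. -/
theorem passed_le (H : MoveBigToFrontRun S L q x) (hS : 2 ≤ S.card) (j : ℕ) :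
    (L j).pos ≤ j ∧ ∀ v ∈ S, (L j).order.idxOf v < (L j).pos →
      q j v + x (j - (L j).pos) v ≤ S.card - 2 + x j v := by
  have hne : S.Nonempty := Finset.card_pos.1 (by omega)
  induction j with
  | zero => simp [H.start, TokenList.start]
  | succ j ih =>
    have hL := H.isOver hne j
    obtain ⟨h, hmem, hh, hidx⟩ := hL.exists_holder
    rw [H.next j h hh]
    by_cases hbig : S.card ≤ q j h
    · simp [hbig, TokenList.next_true hh]
    · simp only [hbig, decide_false, TokenList.next_false]
      by_cases hwrap : (L j).pos + 1 < (L j).order.length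
      -- The token advances by one per round, so `j - pos` stays the round in which it was last at
      -- the front.
      · rw [Nat.mod_eq_of_lt hwrap]
        refine ⟨by omega, fun v hv hlt => ?_⟩
        have hq := H.queue j h hh v hv
        have hm : x (j - (L j).pos) v ≤ x j v := H.mono v hv (Nat.sub_le _ _)
        rw [Nat.add_sub_add_right]
        -- A holder that is not big has at most $|S|-1$ packets and sends one if it has any, which
        -- leaves at most $|S|-2$.
        by_cases hvh : v = h
        · subst hvh
          rw [Function.update_self] at hq
          omega
        · rw [Function.update_of_ne hvh] at hq
          have hvpos : (L j).order.idxOf v ≠ (L j).pos := fun he => hvh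
            ((List.idxOf_inj ((hL.mem_iff v).2 hv)).1 (he.trans hidx.symm))
          have := ih.2 v hv (by omega)
          omega
      · have : (L j).pos + 1 = (L j).order.length := by have := hL.pos_lt; omega
        simp [this]

/-- The phase `s` is kept as long as the potential drops, and is reset when the token wraps around.
The inequality is written without subtraction: potential at most $|S|^2$ plus arrivals since `s`
minus rounds since `s`. -/
theorem exists_weight_le (H : MoveBigToFrontRun S L q x) (hS : 2 ≤ S.card) (j : ℕ) :
    ∃ s ≤ j, (L j).weight S (q j) + ∑ v ∈ S, x s v + j ≤ S.card ^ 2 + ∑ v ∈ S, x j v + s := by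
  have hne : S.Nonempty := Finset.card_pos.1 (by omega)
  induction j with
  | zero =>
    refine ⟨0, le_rfl, ?_⟩
    have : (L 0).weight S (q 0) ≤ ∑ _v ∈ S, S.card :=
      Finset.sum_le_sum fun v hv => by have := H.empty v hv; omega
    rw [Finset.sum_const, smul_eq_mul, ← sq] at this
    omega
  | succ j ih =>
    obtain ⟨s, hs, ih⟩ := ih
    have hL := H.isOver hne j
    obtain ⟨h, hmem, hh, hidx⟩ := hL.exists_holder
    have hq := H.queue j h hh
    have hx : ∀ v ∈ S, x j v ≤ x (j + 1) v := fun v hv => H.mono v hv (Nat.le_succ j)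
    have key : (L (j + 1)).weight S (Function.update (q j) h (q j h - 1)) + 1 ≤
          (L j).weight S (q j) →
        ∃ s ≤ j + 1, (L (j + 1)).weight S (q (j + 1)) + ∑ v ∈ S, x s v + (j + 1) ≤
          S.card ^ 2 + ∑ v ∈ S, x (j + 1) v + s := by
      intro hw
      refine ⟨s, by omega, ?_⟩
      have h1 := TokenList.weight_le_of_arrivals (L := L (j + 1)) (S := S) (q' := q (j + 1))
        (q := Function.update (q j) h (q j h - 1)) (a := fun v => x (j + 1) v - x j v)
        (fun v hv => by have := hq v hv; have := hx v hv; omega)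
      have h2 : ∑ v ∈ S, (x (j + 1) v - x j v) + ∑ v ∈ S, x j v = ∑ v ∈ S, x (j + 1) v := by
        rw [← Finset.sum_add_distrib]
        exact Finset.sum_congr rfl fun v hv => Nat.sub_add_cancel (hx v hv)
      omega
    by_cases hbig : S.card ≤ q j h
    · apply key
      rw [H.next j h hh, decide_eq_true hbig]
      exact hL.weight_next_big hh hbig (by omega)
    · by_cases hwrap : (L j).pos + 1 < S.card
      · apply key
        rw [H.next j h hh, decide_eq_false hbig]
        exact hL.weight_next_small hh hwrap
      · have hlen := hL.length_eq
        have hpos := hL.pos_lt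
        obtain ⟨hle, hpass⟩ := H.passed_le hS j
        -- The token wraps. The new `s` is the round in which it was last at the front, exactly
        -- $|S|$ rounds before `j + 1`. Since then every station was left with a small queue, so
        -- each term is at most $|S|-1$ plus arrivals, and $|S|(|S|-1)+|S|=|S|^2$ pays for the
        -- length of the interval.
        refine ⟨j - (L j).pos, by omega, ?_⟩
        have hv : ∀ v ∈ S, max (q (j + 1) v) (S.card - 1 - (L (j + 1)).rank v) +
            x (j - (L j).pos) v ≤ S.card - 1 + x (j + 1) v := by
          intro v hv
          have hm : x (j - (L j).pos) v ≤ x j v := H.mono v hv (Nat.sub_le _ _)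
          have h1 := hq v hv
          have h2 := hx v hv
          by_cases hvh : v = h
          · subst hvh
            rw [Function.update_self] at h1
            omega
          · rw [Function.update_of_ne hvh] at h1
            have hvpos : (L j).order.idxOf v ≠ (L j).pos := fun he => hvh
              ((List.idxOf_inj ((hL.mem_iff v).2 hv)).1 (he.trans hidx.symm))
            have := hpass v hv (by
              have := List.idxOf_lt_length_of_mem ((hL.mem_iff v).2 hv); omega)
            omega
        have h3 := Finset.sum_le_sum hv
        rw [Finset.sum_add_distrib, Finset.sum_add_distrib, Finset.sum_const, smul_eq_mul] at h3
        have h4 : S.card * (S.card - 1) + S.card = S.card ^ 2 := by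
          obtain ⟨c, hc⟩ : ∃ c, S.card = c + 1 := ⟨S.card - 1, by omega⟩
          rw [hc, Nat.add_sub_cancel]
          ring
        rw [TokenList.weight]
        omega

/-- At any time the number of queued packets exceeds the square of the number of stations by at most
the excess of the packets received in some interval up to this time over its length. -/
theorem exists_sum_le (H : MoveBigToFrontRun S L q x) (hS : 2 ≤ S.card) (j : ℕ) :
    ∃ s ≤ j, ∑ v ∈ S, q j v + ∑ v ∈ S, x s v + j ≤ S.card ^ 2 + ∑ v ∈ S, x j v + s := by
  obtain ⟨s, hs, h⟩ := H.exists_weight_le hS j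
  have := TokenList.sum_le_weight (L := L j) (S := S) (q j)
  exact ⟨s, hs, by omega⟩

end MoveBigToFrontRun

/-! ### Invariants of an execution of k-Subsets, and direct routing. -/

theorem Multiset.sum_filter_eq {α ι : Type*} [Fintype ι] [DecidableEq ι] (m : Multiset α)
    (f : α → ι) : ∑ i, m.filter (fun a => f a = i) = m := by
  induction m using Multiset.induction with
  | empty => simp
  | cons a m ih =>
    simp_rw [Multiset.filter_cons, Finset.sum_add_distrib, ih]
    simp

theorem List.coe_flatMap_finRange {α : Type*} {m : ℕ} (f : Fin m → List α) :
    (((List.finRange m).flatMap f : List α) : Multiset α) = ∑ i, (f i : Multiset α) := by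
  rw [← Multiset.coe_bind]
  rfl

theorem List.cons_eraseIdx_perm {α : Type*} {l : List α} {i : ℕ} {a : α} (h : l[i]? = some a) :
    (a :: l.eraseIdx i).Perm l := by
  obtain ⟨hi, rfl⟩ := List.getElem?_eq_some_iff.1 h
  exact List.getElem_cons_eraseIdx_perm hi

theorem RoutingAlgorithm.mem_onStations {n : ℕ} {C : Type*} (alg : RoutingAlgorithm n C) (t : ℕ)
    (σ : Fin n → alg.State) (v : Fin n) : v ∈ alg.onStations t σ ↔ alg.isOn v t (σ v) := by
  simp [onStations]

namespace SubsetsRules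

variable {n k : ℕ} {C : Type*} (R : SubsetsRules n k C)

theorem sum_freshTo (s : SubsetsState n k C) :
    ∑ w, (freshTo s w : Multiset (Packet n C)) = s.fresh := by
  simp_rw [freshTo, ← Multiset.filter_coe]
  exact Multiset.sum_filter_eq _ _

theorem sum_allotted (v : Fin n) (s : SubsetsState n k C) (w : Fin n) :
    ∑ i, (R.allotted v s w i : Multiset (Packet n C)) = freshTo s w := by
  simp_rw [allotted, ← Multiset.map_coe, ← Multiset.filter_coe]
  rw [← Multiset.coe_mapAddMonoidHom, ← map_sum, Multiset.sum_filter_eq]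
  simp

theorem sum_length_allotted (v : Fin n) (s : SubsetsState n k C) (w : Fin n) :
    ∑ i, (R.allotted v s w i).length = (freshTo s w).length := by
  have := congrArg Multiset.card (R.sum_allotted v s w)
  simpa using this

theorem length_allotted (v : Fin n) (s : SubsetsState n k C) (w : Fin n) (i : Thread n k) :
    (R.allotted v s w i).length =
      (Finset.univ.filter fun a => R.place v w (s.count w) (freshTo s w) a = i).card := by
  rw [allotted, List.length_map,
    ← List.toFinset_card_of_nodup ((List.nodup_finRange _).filter _)]
  congr 1
  ext a
  simp

theorem mem_of_mem_allotted {v : Fin n} {s : SubsetsState n k C} {w : Fin n} {i : Thread n k}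
    {p : Packet n C} (hp : p ∈ R.allotted v s w i) :
    p.dest = w ∧ v ∈ (R.A i).1 ∧ w ∈ (R.A i).1 := by
  obtain ⟨a, ha, rfl⟩ := List.mem_map.1 hp
  have ha' : R.place v w (s.count w) (freshTo s w) a = i := by simpa using ha
  have hmem : (freshTo s w).get a ∈ freshTo s w := List.get_mem _ _
  refine ⟨?_, ha' ▸ R.place_mem _ _ _ _ _⟩
  simpa using (List.mem_filter.1 hmem).2

/-- All the packets stored in a station. -/
def stored (s : SubsetsState n k C) : Multiset (Packet n C) :=
  s.fresh + ∑ i, (s.threadQueue i : Multiset (Packet n C))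

theorem stored_allocate (v : Fin n) (s : SubsetsState n k C) :
    stored (R.allocate v s) = stored s := by
  simp only [stored, allocate, ← Multiset.coe_add, List.coe_flatMap_finRange,
    Finset.sum_add_distrib]
  rw [Finset.sum_comm (f := fun i w => (R.allotted v s w i : Multiset (Packet n C)))]
  simp_rw [sum_allotted, sum_freshTo]
  simp [add_comm]

/-- The properties of the states of the stations that hold in all rounds. -/
structure Consistent (σ : Fin n → SubsetsState n k C) : Prop where
  tokens : ∀ i, ∃ L : TokenList n, L.IsOver (R.A i).1 ∧ ∀ v ∈ (R.A i).1, (σ v).tokenList i = L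
  mem : ∀ v i, ∀ p ∈ (σ v).threadQueue i, v ∈ (R.A i).1 ∧ p.dest ∈ (R.A i).1
  count_eq_zero : ∀ v w i, ¬(v ∈ (R.A i).1 ∧ w ∈ (R.A i).1) → (σ v).count w i = 0
  balanced : ∀ v w i j, v ∈ (R.A i).1 → w ∈ (R.A i).1 → v ∈ (R.A j).1 → w ∈ (R.A j).1 →
    (σ v).count w i ≤ (σ v).count w j + 1

variable {R}

theorem Consistent.allocate {σ : Fin n → SubsetsState n k C} (h : R.Consistent σ) :
    R.Consistent fun v => R.allocate v (σ v) where
  tokens := h.tokens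
  mem v i p hp := by
    rcases List.mem_append.1 hp with hp | hp
    · exact h.mem v i p hp
    · obtain ⟨w, -, hp⟩ := List.mem_flatMap.1 hp
      obtain ⟨rfl, h⟩ := R.mem_of_mem_allotted hp
      exact h
  count_eq_zero v w i hi := by
    have : R.allotted v (σ v) w i = [] := List.eq_nil_iff_forall_not_mem.2 fun p hp =>
      hi (R.mem_of_mem_allotted hp).2
    simp [SubsetsRules.allocate, this, h.count_eq_zero v w i hi]
  balanced v w i j h1 h2 h3 h4 := by
    simp only [SubsetsRules.allocate, length_allotted]
    exact R.place_balanced v w _ _ (h.balanced v w) i j h1 h2 h3 h4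

variable (R)

theorem message_eq_none {v : Fin n} {i : Thread n k} {s : SubsetsState n k C}
    (h : (s.tokenList i).holder ≠ some v) : R.message v i s = none := if_neg h

theorem message_holder {v : Fin n} {i : Thread n k} {s : SubsetsState n k C}
    (h : (s.tokenList i).holder = some v) :
    R.message v i s = (s.threadQueue i)[R.pick v i (s.threadQueue i)]?.map fun p =>
      ⟨some p, [decide (k ≤ (s.threadQueue i).length)]⟩ := if_pos h

/-- Silence is read as "not big", which is right because an empty queue has fewer than `k` packets.
-/
theorem decide_control_message {v : Fin n} {i : Thread n k} {s : SubsetsState n k C}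
    (h : (s.tokenList i).holder = some v) (hk : 0 < k) :
    decide ((R.message v i s).map Message.control = some [true]) =
      decide (k ≤ (s.threadQueue i).length) := by
  rw [R.message_holder h]
  by_cases hq : s.threadQueue i = []
  · simp [hq, hk.ne']
  · simp [List.getElem?_eq_getElem (R.pick_lt v i _ hq)]

theorem isSome_message {v : Fin n} {i : Thread n k} {s : SubsetsState n k C}
    (h : (s.tokenList i).holder = some v) :
    (R.message v i s).isSome ↔ s.threadQueue i ≠ [] := by
  rw [R.message_holder h]
  by_cases hq : s.threadQueue i = []
  · simp [hq]
  · simp [List.getElem?_eq_getElem (R.pick_lt v i _ hq), hq]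

/-- The states of the stations at the beginning of each round of the execution of k-Subsets. -/
noncomputable def states (hkn : k < n) (inj : Injection n C) (t : ℕ) :
    Fin n → SubsetsState n k C :=
  (kSubsets hkn R).exec inj t

/-- The feedback from the channel in an execution of k-Subsets. -/
noncomputable def feedback (hkn : k < n) (t : ℕ) (σ : Fin n → SubsetsState n k C) (v : Fin n) :
    Option (Message n C) :=
  (kSubsets hkn R).feedback t σ v

/-- The states of the stations at the end of a round, before the allocation in the last round of a
phase. -/
noncomputable def beforeAllocation (hkn : k < n) (inj : Injection n C) (t : ℕ) (v : Fin n) :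
    SubsetsState n k C :=
  let s := R.states hkn inj t v
  let s₁ := if v ∈ (R.A (threadOf hkn t)).1 then
    R.afterRound v (threadOf hkn t) s (R.feedback hkn t (R.states hkn inj t) v) else s
  { s₁ with fresh := s₁.fresh ++ inj t v }

theorem states_zero (hkn : k < n) (inj : Injection n C) (v : Fin n) :
    R.states hkn inj 0 v =
      ⟨[], fun _ _ => 0, fun _ => [], fun i => TokenList.start (R.A i).1⟩ := rfl

theorem states_succ (hkn : k < n) (inj : Injection n C) (t : ℕ) (v : Fin n) :
    R.states hkn inj (t + 1) v =
      if n.choose k ∣ t + 1 then R.allocate v (R.beforeAllocation hkn inj t v)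
      else R.beforeAllocation hkn inj t v := rfl

theorem coe_queue (hkn : k < n) (inj : Injection n C) (t : ℕ) (v : Fin n) :
    ((kSubsets hkn R).queue ((kSubsets hkn R).exec inj t v) : Multiset (Packet n C)) =
      stored (R.states hkn inj t v) := by
  rw [stored, ← List.coe_flatMap_finRange, Multiset.coe_add]
  rfl

theorem mem_onStations (hkn : k < n) (t : ℕ) (σ : Fin n → SubsetsState n k C) (v : Fin n) :
    v ∈ (kSubsets hkn R).onStations t σ ↔ v ∈ (R.A (threadOf hkn t)).1 :=
  (kSubsets hkn R).mem_onStations t σ v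

variable {R}

/-- The active stations agree on the holder, so no two of them transmit and collisions never occur.
-/
theorem heardFrom_iff (hkn : k < n) {t : ℕ} {σ : Fin n → SubsetsState n k C} {h : Fin n}
    (hmem : h ∈ (R.A (threadOf hkn t)).1)
    (hh : ∀ v ∈ (R.A (threadOf hkn t)).1, ((σ v).tokenList (threadOf hkn t)).holder = some h)
    (v : Fin n) (m : Message n C) :
    (kSubsets hkn R).HeardFrom t σ v m ↔ v = h ∧ R.message h (threadOf hkn t) (σ h) = some m := by
  have hnone : ∀ u ∈ (R.A (threadOf hkn t)).1, u ≠ h →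
      R.message u (threadOf hkn t) (σ u) = none := fun u hu hne =>
    R.message_eq_none (by simpa [hh u hu] using hne.symm)
  constructor
  · rintro ⟨hv, hm, -⟩
    have hm' : R.message v (threadOf hkn t) (σ v) = some m := hm
    by_cases hvh : v = h
    · exact ⟨hvh, hvh ▸ hm'⟩
    · simp [hnone v ((R.mem_onStations hkn t σ v).1 hv) hvh] at hm'
  · rintro ⟨rfl, hm⟩
    exact ⟨(R.mem_onStations hkn t σ v).2 hmem, hm,
      fun u hu => hnone u ((R.mem_onStations hkn t σ u).1 hu)⟩

theorem feedback_eq (hkn : k < n) {t : ℕ} {σ : Fin n → SubsetsState n k C} {h v : Fin n}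
    (hmem : h ∈ (R.A (threadOf hkn t)).1)
    (hh : ∀ v ∈ (R.A (threadOf hkn t)).1, ((σ v).tokenList (threadOf hkn t)).holder = some h)
    (hv : v ∈ (R.A (threadOf hkn t)).1) :
    R.feedback hkn t σ v = R.message h (threadOf hkn t) (σ h) := by
  have h1 : R.feedback hkn t σ v = (kSubsets hkn R).heard t σ :=
    if_pos ((R.mem_onStations hkn t σ v).2 hv)
  rw [h1]
  by_cases hex : ∃ m v, (kSubsets hkn R).HeardFrom t σ v m
  · obtain ⟨v, hv⟩ := hex.choose_spec
    exact Eq.trans (dif_pos hex) ((heardFrom_iff hkn hmem hh _ _).1 hv).2.symm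
  · refine Eq.trans (dif_neg hex) ?_
    cases hm : R.message h (threadOf hkn t) (σ h) with
    | none => rfl
    | some m => exact absurd ⟨m, h, (heardFrom_iff hkn hmem hh h m).2 ⟨rfl, hm⟩⟩ hex

/-- This eliminates the channel: the round becomes an explicit function of the states. Silent rounds
need no separate case, since erasing from an empty queue does nothing. -/
theorem beforeAllocation_eq (hkn : k < n) (hk : 0 < k) {inj : Injection n C} {t : ℕ} {h : Fin n}
    {i : Thread n k} (hi : i = threadOf hkn t) {s : Fin n → SubsetsState n k C}
    (hs : s = R.states hkn inj t) (hmem : h ∈ (R.A i).1)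
    (hh : ∀ v ∈ (R.A i).1, ((s v).tokenList i).holder = some h) (v : Fin n) :
    R.beforeAllocation hkn inj t v =
      { fresh := (s v).fresh ++ inj t v
        count := (s v).count
        threadQueue :=
          if v = h then Function.update (s h).threadQueue i
            (((s h).threadQueue i).eraseIdx (R.pick h i ((s h).threadQueue i)))
          else (s v).threadQueue
        tokenList :=
          if v ∈ (R.A i).1 then Function.update (s v).tokenList i
            (((s v).tokenList i).next (decide (k ≤ ((s h).threadQueue i).length)))
          else (s v).tokenList } := by
  subst hi hs
  by_cases hv : v ∈ (R.A (threadOf hkn t)).1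
  · have hbig := R.decide_control_message (hh h hmem) hk
    have hsome := R.isSome_message (hh h hmem)
    simp only [beforeAllocation, if_pos hv, afterRound, feedback_eq hkn hmem hh hv, hbig]
    congr 1
    by_cases hvh : v = h
    · subst hvh
      by_cases hq : (R.states hkn inj t v).threadQueue (threadOf hkn t) = []
      · rw [if_neg (by rw [hsome]; exact fun h => h.2 hq), if_pos rfl]
        symm
        simp [hq]
      · rw [if_pos ⟨hh v hv, hsome.2 hq⟩, if_pos rfl]
    · rw [if_neg hvh, if_neg]
      rintro ⟨h1, -⟩
      exact hvh (by simpa [hh v hv] using h1.symm)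
  · have hvh : v ≠ h := fun he => hv (he ▸ hmem)
    simp only [beforeAllocation, if_neg hv, if_neg hvh]

theorem Consistent.exists_holder {σ : Fin n → SubsetsState n k C}
    (H : R.Consistent σ) (i : Thread n k) :
    ∃ h ∈ (R.A i).1, ∀ v ∈ (R.A i).1, ((σ v).tokenList i).holder = some h := by
  obtain ⟨L, hL, hv⟩ := H.tokens i
  obtain ⟨h, hmem, hh, -⟩ := hL.exists_holder
  exact ⟨h, hmem, fun v hmv => by rw [hv v hmv, hh]⟩

theorem Consistent.beforeAllocation (hkn : k < n) (hk : 0 < k) {inj : Injection n C} {t : ℕ}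
    (H : R.Consistent (R.states hkn inj t)) :
    R.Consistent (R.beforeAllocation hkn inj t) := by
  obtain ⟨h, hmem, hh⟩ := H.exists_holder (threadOf hkn t)
  have hb := beforeAllocation_eq hkn hk rfl rfl hmem hh
  refine ⟨fun i => ?_, fun v i p hp => ?_, fun v w i => ?_, fun v w i j => ?_⟩
  · obtain ⟨L, hL, hv⟩ := H.tokens i
    by_cases hi : i = threadOf hkn t
    · subst hi
      refine ⟨_, hL.next (decide (k ≤ ((R.states hkn inj t h).threadQueue (threadOf hkn t)).length)),
        fun v hmv => ?_⟩
      rw [hb]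
      dsimp only
      rw [if_pos hmv, Function.update_self, hv v hmv]
    · refine ⟨L, hL, fun v hmv => ?_⟩
      rw [hb, ← hv v hmv]
      dsimp only
      split_ifs
      · rw [Function.update_of_ne hi]
      · rfl
  · apply H.mem v i p
    rw [hb] at hp
    dsimp only at hp
    split_ifs at hp with hvh
    · subst hvh
      by_cases hi : i = threadOf hkn t
      · subst hi
        rw [Function.update_self] at hp
        exact List.mem_of_mem_eraseIdx hp
      · rwa [Function.update_of_ne hi] at hp
    · exact hp
  · rw [hb]
    exact H.count_eq_zero v w i
  · rw [hb]
    exact H.balanced v w i j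

theorem consistent_states (hkn : k < n) (hk : 0 < k) (inj : Injection n C) (t : ℕ) :
    R.Consistent (R.states hkn inj t) := by
  induction t with
  | zero =>
    refine ⟨fun i => ⟨_, .start (Finset.card_pos.1 ?_), fun v _ => rfl⟩, ?_, fun _ _ _ _ => rfl,
      fun _ _ _ _ _ _ _ _ => Nat.zero_le _⟩
    · rw [(R.A i).2]
      exact hk
    · intro v i p hp
      exact absurd hp List.not_mem_nil
  | succ t ih =>
    have hb := ih.beforeAllocation hkn hk
    have hs := funext (R.states_succ hkn inj t)
    by_cases hd : n.choose k ∣ t + 1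
    · simp only [if_pos hd] at hs
      exact hs ▸ hb.allocate
    · simp only [if_neg hd] at hs
      exact hs ▸ hb

theorem stored_states_succ (hkn : k < n) (inj : Injection n C) (t : ℕ) (v : Fin n) :
    stored (R.states hkn inj (t + 1) v) = stored (R.beforeAllocation hkn inj t v) := by
  rw [states_succ]
  split_ifs
  · exact R.stored_allocate v _
  · rfl

theorem energyOblivious (hkn : k < n) : (kSubsets hkn R).EnergyOblivious k :=
  ⟨fun t => (R.A (threadOf hkn t)).1, fun t => (R.A (threadOf hkn t)).2.le,
    fun _ _ => Finset.ext fun v => R.mem_onStations hkn _ _ v⟩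

/-- A queue of thread $i$ contains only packets addressed to stations of $A_i$, all of which are
switched on when the packet is sent. -/
theorem routesDirectly (hkn : k < n) (hk : 0 < k) : (kSubsets hkn R).RoutesDirectly := by
  intro inj t v
  have H : R.Consistent (R.states hkn inj t) := consistent_states hkn hk inj t
  obtain ⟨h, hmem, hh⟩ := H.exists_holder (threadOf hkn t)
  have hb := beforeAllocation_eq hkn hk rfl rfl hmem hh v
  have hmsg := R.message_holder (hh h hmem)
  have hfrom : ∀ m, (kSubsets hkn R).HeardFrom t ((kSubsets hkn R).exec inj t) v m ↔
    v = h ∧ R.message h (threadOf hkn t) (R.states hkn inj t h) = some m :=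
    heardFrom_iff hkn hmem hh v
  simp only [hfrom, coe_queue, stored_states_succ, ← Multiset.mem_coe]
  set s := R.states hkn inj t
  set i := threadOf hkn t
  constructor
  · rintro m p ⟨rfl, hm⟩ hp
    rw [hm, eq_comm, Option.map_eq_some_iff] at hmsg
    obtain ⟨p', hget, rfl⟩ := hmsg
    obtain rfl : p' = p := by simpa using hp
    have hpq := List.mem_of_getElem? hget
    refine ⟨(R.mem_onStations hkn t _ _).2 (H.mem v _ _ hpq).2, ?_, ?_⟩
    · rw [stored, Multiset.mem_add, Multiset.mem_sum]
      exact Or.inr ⟨_, Finset.mem_univ _, hpq⟩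
    · rw [hb]
      simp only [stored, if_true]
      rw [← Finset.add_sum_erase _ _ (Finset.mem_univ i),
        ← Finset.add_sum_erase Finset.univ
          (fun i => ((s v).threadQueue i : Multiset (Packet n C))) (Finset.mem_univ i),
        Function.update_self, ← Multiset.coe_eq_coe.2 (List.cons_eraseIdx_perm hget),
        ← Multiset.cons_coe, Finset.sum_congr rfl fun j hj => by
          rw [Function.update_of_ne (Finset.ne_of_mem_erase hj)], ← Multiset.coe_add]
      simp only [← Multiset.singleton_add]
      abel
  · intro hno
    have hq : (if v = h then Function.update (s h).threadQueue i
          (((s h).threadQueue i).eraseIdx (R.pick h i ((s h).threadQueue i)))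
          else (s v).threadQueue) = (s v).threadQueue := by
      split_ifs with hvh
      · subst hvh
        by_cases hq : (s v).threadQueue i = []
        · simp [hq]
        · rw [List.getElem?_eq_getElem (R.pick_lt _ _ _ hq)] at hmsg
          exact absurd ⟨_, _, ⟨rfl, hmsg⟩, rfl⟩ hno
      · rfl
    rw [hb, hq]
    simp only [stored, ← Multiset.coe_add]
    abel

end SubsetsRules

/-! ### From rounds to phases: one round of each thread per phase. -/

namespace SubsetsRules

variable {n k : ℕ} {C : Type*} {R : SubsetsRules n k C}

/-- What has happened between the beginning of a phase, with states `s₀`, and the end of its first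
`r` rounds, with states `s`, to the queues and lists of thread `i`, whose token was at `h`. -/
structure PhaseProgress (R : SubsetsRules n k C) (i : Thread n k) (h : Fin n)
    (s₀ s : Fin n → SubsetsState n k C) (r : ℕ) : Prop where
  count : ∀ v, (s v).count = (s₀ v).count
  before : r ≤ i.1 → ∀ v, (s v).threadQueue i = (s₀ v).threadQueue i ∧
    (s v).tokenList i = (s₀ v).tokenList i
  after : i.1 < r → ∀ v,
    ((s v).threadQueue i).length = Function.update (fun u => ((s₀ u).threadQueue i).length) h
      (((s₀ h).threadQueue i).length - 1) v ∧
    (v ∈ (R.A i).1 → (s v).tokenList i =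
      ((s₀ v).tokenList i).next (decide (k ≤ ((s₀ h).threadQueue i).length)))

theorem PhaseProgress.beforeAllocation (hkn : k < n) (hk : 0 < k) {inj : Injection n C} {j r : ℕ}
    (hr : r < n.choose k) {i : Thread n k} {h : Fin n} {s₀ : Fin n → SubsetsState n k C}
    (hmem : h ∈ (R.A i).1) (hh : ∀ v ∈ (R.A i).1, ((s₀ v).tokenList i).holder = some h)
    (H : R.PhaseProgress i h s₀ (R.states hkn inj (n.choose k * j + r)) r) :
    R.PhaseProgress i h s₀ (R.beforeAllocation hkn inj (n.choose k * j + r)) (r + 1) := by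
  have hthread : threadOf hkn (n.choose k * j + r) = ⟨r, hr⟩ := by
    simp [threadOf, Nat.mod_eq_of_lt hr]
  obtain ⟨h', hmem', hh'⟩ :=
    (consistent_states (R := R) hkn hk inj (n.choose k * j + r)).exists_holder ⟨r, hr⟩
  have hb := beforeAllocation_eq hkn hk hthread.symm rfl hmem' hh'
  have hcount : ∀ v, (R.beforeAllocation hkn inj (n.choose k * j + r) v).count =
      (s₀ v).count := fun v => by rw [hb]; exact H.count v
  by_cases hir : i = ⟨r, hr⟩
  · subst hir
    -- This is the only round of thread `i` in the phase, so its lists are still those of the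
    -- beginning of the phase and the two holders coincide.
    have hbef := H.before le_rfl
    obtain rfl : h = h' := by
      have := hh' h hmem
      rw [(hbef h).2, hh h hmem] at this
      simpa using this
    refine ⟨hcount, fun hle => absurd hle (Nat.not_succ_le_self r), fun _ v => ⟨?_, fun hv => ?_⟩⟩
    · rw [hb]
      dsimp only
      by_cases hvh : v = h
      · subst hvh
        rw [if_pos rfl, Function.update_self, Function.update_self, (hbef v).1]
        by_cases hq : (s₀ v).threadQueue ⟨r, hr⟩ = []
        · simp [hq]
        · rw [List.length_eraseIdx_of_lt (R.pick_lt _ _ _ hq)]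
      · rw [if_neg hvh, Function.update_of_ne hvh, (hbef v).1]
    · rw [hb]
      dsimp only
      rw [if_pos hv, Function.update_self, (hbef v).2, (hbef h).1]
  · have hne : i.1 ≠ r := fun he => hir (Fin.ext he)
    have hsame : ∀ v, (R.beforeAllocation hkn inj (n.choose k * j + r) v).threadQueue i =
          (R.states hkn inj (n.choose k * j + r) v).threadQueue i ∧
        (R.beforeAllocation hkn inj (n.choose k * j + r) v).tokenList i =
          (R.states hkn inj (n.choose k * j + r) v).tokenList i := by
      intro v
      rw [hb]
      dsimp only
      constructor
      · split_ifs with hvh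
        · rw [hvh, Function.update_of_ne hir]
        · rfl
      · split_ifs
        · rw [Function.update_of_ne hir]
        · rfl
    refine ⟨hcount, fun hle v => ?_, fun hlt v => ?_⟩
    · rw [(hsame v).1, (hsame v).2]
      exact H.before (by omega) v
    · rw [(hsame v).1, (hsame v).2]
      exact H.after (by omega) v

theorem not_dvd_add {γ j r : ℕ} (h0 : 0 < r) (hr : r < γ) : ¬ γ ∣ γ * j + r := fun h =>
  absurd (Nat.le_of_dvd h0 ((Nat.dvd_add_right (Nat.dvd_mul_right γ j)).1 h)) (by omega)

theorem phaseProgress_states (hkn : k < n) (hk : 0 < k) (inj : Injection n C) (j : ℕ)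
    {i : Thread n k} {h : Fin n} (hmem : h ∈ (R.A i).1)
    (hh : ∀ v ∈ (R.A i).1,
      ((R.states hkn inj (n.choose k * j) v).tokenList i).holder = some h)
    {r : ℕ} (hr : r < n.choose k) :
    R.PhaseProgress i h (R.states hkn inj (n.choose k * j))
      (R.states hkn inj (n.choose k * j + r)) r := by
  induction r with
  | zero => exact ⟨fun _ => rfl, fun _ _ => ⟨rfl, rfl⟩, fun hlt => absurd hlt (Nat.not_lt_zero _)⟩
  | succ r ih =>
    have hb := (ih (by omega)).beforeAllocation hkn hk (by omega) hmem hh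
    have hs : R.states hkn inj (n.choose k * j + (r + 1)) =
        R.beforeAllocation hkn inj (n.choose k * j + r) := funext fun v => by
      rw [← add_assoc, states_succ, if_neg]
      rw [add_assoc]
      exact not_dvd_add (Nat.succ_pos r) hr
    rw [hs]
    exact hb

theorem states_phase_succ (hkn : k < n) (inj : Injection n C) (j : ℕ) (v : Fin n) :
    R.states hkn inj (n.choose k * (j + 1)) v =
      R.allocate v (R.beforeAllocation hkn inj (n.choose k * j + (n.choose k - 1)) v) := by
  have hγ : 0 < n.choose k := Nat.choose_pos hkn.le
  have : n.choose k * (j + 1) = n.choose k * j + (n.choose k - 1) + 1 := by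
    rw [mul_add, mul_one, add_assoc, Nat.sub_add_cancel hγ]
  rw [this, states_succ, if_pos (this ▸ Nat.dvd_mul_right _ _)]

theorem length_flatMap_allotted (v : Fin n) (s : SubsetsState n k C) (i : Thread n k) :
    ((List.finRange n).flatMap fun w => R.allotted v s w i).length =
      ∑ w, (R.allotted v s w i).length := by
  have := congrArg Multiset.card (List.coe_flatMap_finRange fun w => R.allotted v s w i)
  simpa using this

/-- What happens in a phase to the queues and lists of a thread. -/
theorem phase_step (hkn : k < n) (hk : 0 < k) (inj : Injection n C) (j : ℕ)
    {i : Thread n k} {h : Fin n} (hmem : h ∈ (R.A i).1)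
    (hh : ∀ v ∈ (R.A i).1,
      ((R.states hkn inj (n.choose k * j) v).tokenList i).holder = some h) (v : Fin n) :
    let s₀ := R.states hkn inj (n.choose k * j)
    let s₁ := R.states hkn inj (n.choose k * (j + 1))
    (∀ w, (s₀ v).count w i ≤ (s₁ v).count w i) ∧
    ((s₁ v).threadQueue i).length + ∑ w, (s₀ v).count w i =
      Function.update (fun u => ((s₀ u).threadQueue i).length) h
        (((s₀ h).threadQueue i).length - 1) v + ∑ w, (s₁ v).count w i ∧
    (v ∈ (R.A i).1 → (s₁ v).tokenList i =
      ((s₀ v).tokenList i).next (decide (k ≤ ((s₀ h).threadQueue i).length))) := by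
  intro s₀ s₁
  have hγ : 0 < n.choose k := Nat.choose_pos hkn.le
  -- The last round of the phase is treated separately, because the allocation follows it.
  have H := (phaseProgress_states hkn hk inj j hmem hh
    (Nat.sub_lt hγ one_pos)).beforeAllocation hkn hk (Nat.sub_lt hγ one_pos) hmem hh
  obtain ⟨h1, h2⟩ := H.after (by have := i.2; omega) v
  have hc := H.count v
  have hs : s₁ v = R.allocate v (R.beforeAllocation hkn inj (n.choose k * j + (n.choose k - 1)) v) :=
    states_phase_succ hkn inj j v
  rw [hs]
  refine ⟨fun w => ?_, ?_, h2⟩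
  · simp only [allocate, hc]
    exact Nat.le_add_right _ _
  · simp only [allocate, hc, List.length_append, h1, length_flatMap_allotted,
      Finset.sum_add_distrib, s₀]
    omega

/-- In the rounds of a thread its stations execute Move-Big-To-Front. -/
theorem moveBigToFrontRun (hkn : k < n) (hk : 0 < k) (inj : Injection n C) (i : Thread n k)
    {v₀ : Fin n} (hv₀ : v₀ ∈ (R.A i).1) :
    MoveBigToFrontRun (R.A i).1 (fun j => (R.states hkn inj (n.choose k * j) v₀).tokenList i)
      (fun j v => ((R.states hkn inj (n.choose k * j) v).threadQueue i).length)
      (fun j v => ∑ w, (R.states hkn inj (n.choose k * j) v).count w i) := by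
  have hall : ∀ j h, ((R.states hkn inj (n.choose k * j) v₀).tokenList i).holder = some h →
      h ∈ (R.A i).1 ∧ ∀ v ∈ (R.A i).1,
        ((R.states hkn inj (n.choose k * j) v).tokenList i).holder = some h := by
    intro j h hh
    obtain ⟨h', hmem, hh'⟩ :=
      (consistent_states (R := R) hkn hk inj (n.choose k * j)).exists_holder i
    obtain rfl : h' = h := by simpa [hh' v₀ hv₀] using hh
    exact ⟨hmem, hh'⟩
  refine ⟨rfl, fun v _ => rfl, fun v _ => monotone_nat_of_le_succ fun j => ?_, fun j h hh => ?_,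
    fun j h hh v _ => ?_⟩
  · obtain ⟨h, hmem, hh⟩ :=
      (consistent_states (R := R) hkn hk inj (n.choose k * j)).exists_holder i
    exact Finset.sum_le_sum fun w _ => (phase_step hkn hk inj j hmem hh v).1 w
  · obtain ⟨hmem, hh'⟩ := hall j h hh
    rw [(R.A i).2]
    exact (phase_step hkn hk inj j hmem hh' v₀).2.2 hv₀
  · obtain ⟨hmem, hh'⟩ := hall j h hh
    exact (phase_step hkn hk inj j hmem hh' v).2.1

/-! ### Accounting for injected packets. -/

/-- The number of packets injected before round `t`. -/
def injected (inj : Injection n C) (t : ℕ) : ℕ :=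
  ∑ r ∈ Finset.range t, ∑ v, (inj r v).length

theorem injected_sub_le {inj : Injection n C} {ρ β : ℝ} (h : inj.OfType ρ β) {s t : ℕ}
    (hst : s ≤ t) : (injected inj t : ℝ) - injected inj s ≤ ρ * (t - s : ℝ) + β := by
  have h1 := h.2.2.2 s (t - s)
  rw [Nat.add_sub_cancel' hst, Nat.cast_sub hst] at h1
  have h2 := Finset.sum_range_add_sum_Ico (fun r => ∑ v, (inj r v).length) hst
  rw [injected, injected, ← h2]
  push_cast at h1 ⊢
  linarith

theorem sum_length_freshTo (s : SubsetsState n k C) :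
    ∑ w, (freshTo s w).length = s.fresh.length := by
  have := congrArg Multiset.card (sum_freshTo s)
  simpa using this

theorem sum_count_allocate (v : Fin n) (s : SubsetsState n k C) :
    ∑ w, ∑ i, (R.allocate v s).count w i + (R.allocate v s).fresh.length =
      ∑ w, ∑ i, s.count w i + s.fresh.length := by
  simp only [allocate, Finset.sum_add_distrib, sum_length_allotted, sum_length_freshTo]
  simp

/-- Counters never decrease on delivery, so every injected packet remains accounted for, either as
fresh or in exactly one counter. -/
theorem sum_count_add_fresh (hkn : k < n) (hk : 0 < k) (inj : Injection n C) (t : ℕ) :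
    ∑ v, (∑ w, ∑ i, (R.states hkn inj t v).count w i + (R.states hkn inj t v).fresh.length) =
      injected inj t := by
  induction t with
  | zero => simp [states_zero, injected]
  | succ t ih =>
    rw [injected, Finset.sum_range_succ, ← injected, ← ih, ← Finset.sum_add_distrib]
    refine Finset.sum_congr rfl fun v _ => ?_
    obtain ⟨h, hmem, hh⟩ := (consistent_states (R := R) hkn hk inj t).exists_holder
      (threadOf hkn t)
    have hb := beforeAllocation_eq hkn hk rfl rfl hmem hh v
    have : ∑ w, ∑ i, (R.states hkn inj (t + 1) v).count w i +
          (R.states hkn inj (t + 1) v).fresh.length =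
        ∑ w, ∑ i, (R.beforeAllocation hkn inj t v).count w i +
          (R.beforeAllocation hkn inj t v).fresh.length := by
      rw [states_succ]
      split_ifs
      · exact R.sum_count_allocate v _
      · rfl
    rw [this, hb, List.length_append, add_assoc]

theorem fresh_phase (hkn : k < n) (inj : Injection n C) (j : ℕ) (v : Fin n) :
    (R.states hkn inj (n.choose k * j) v).fresh = [] := by
  cases j with
  | zero => rfl
  | succ j => rw [states_phase_succ]; rfl

theorem sum_count_phase (hkn : k < n) (hk : 0 < k) (inj : Injection n C) (j : ℕ) :
    ∑ v, ∑ w, ∑ i, (R.states hkn inj (n.choose k * j) v).count w i =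
      injected inj (n.choose k * j) := by
  rw [← sum_count_add_fresh (R := R) hkn hk]
  simp [fresh_phase]

/-- Within a phase thread queues can only shrink, and all new packets stay fresh. The argument `+ 1`
on the right is due to `queueSize` including the injections of the current round. -/
theorem queueSize_le (hkn : k < n) (hk : 0 < k) (inj : Injection n C) (j : ℕ) {r : ℕ}
    (hr : r < n.choose k) :
    (kSubsets hkn R).queueSize inj (n.choose k * j + r) + injected inj (n.choose k * j) ≤
      ∑ i, ∑ v ∈ (R.A i).1, ((R.states hkn inj (n.choose k * j) v).threadQueue i).length +
        injected inj (n.choose k * j + r + 1) := by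
  set t := n.choose k * j + r with ht
  have hprog : ∀ i, ∃ h, R.PhaseProgress i h (R.states hkn inj (n.choose k * j))
      (R.states hkn inj t) r := by
    intro i
    obtain ⟨h, hmem, hh⟩ :=
      (consistent_states (R := R) hkn hk inj (n.choose k * j)).exists_holder i
    exact ⟨h, phaseProgress_states hkn hk inj j hmem hh hr⟩
  have hq : ∀ i v, ((R.states hkn inj t v).threadQueue i).length ≤
      ((R.states hkn inj (n.choose k * j) v).threadQueue i).length := by
    intro i v
    obtain ⟨h, H⟩ := hprog i
    by_cases hi : r ≤ i.1
    · rw [(H.before hi v).1]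
    · rw [(H.after (by omega) v).1]
      by_cases hvh : v = h
      · subst hvh
        simp
      · simp [Function.update_of_ne hvh]
  have hcount : ∀ v, (R.states hkn inj t v).count =
      (R.states hkn inj (n.choose k * j) v).count := by
    obtain ⟨h, H⟩ := hprog ⟨r, hr⟩
    exact H.count
  have hfresh : ∑ v, (R.states hkn inj t v).fresh.length + injected inj (n.choose k * j) =
      injected inj t := by
    rw [← sum_count_add_fresh (R := R) hkn hk inj t, ← sum_count_phase (R := R) hkn hk,
      Finset.sum_add_distrib, add_comm]
    simp only [hcount]
  have hsize : (kSubsets hkn R).queueSize inj t =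
      ∑ v, (R.states hkn inj t v).fresh.length +
      ∑ i, ∑ v, ((R.states hkn inj t v).threadQueue i).length + ∑ v, (inj t v).length := by
    rw [RoutingAlgorithm.queueSize, Finset.sum_add_distrib]
    congr 1
    rw [Finset.sum_comm, ← Finset.sum_add_distrib]
    refine Finset.sum_congr rfl fun v _ => ?_
    have := congrArg Multiset.card (R.coe_queue hkn inj t v)
    simpa [stored] using this
  have hle : ∑ i, ∑ v, ((R.states hkn inj t v).threadQueue i).length ≤
      ∑ i, ∑ v ∈ (R.A i).1,
        ((R.states hkn inj (n.choose k * j) v).threadQueue i).length := by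
    refine Finset.sum_le_sum fun i _ => ?_
    rw [← Finset.sum_subset (Finset.subset_univ (R.A i).1) fun v _ hv => ?_]
    · exact Finset.sum_le_sum fun v _ => hq i v
    · rw [List.length_eq_zero_iff, List.eq_nil_iff_forall_not_mem]
      exact fun p hp => hv ((consistent_states (R := R) hkn hk inj t).mem v i p hp).1
  have hinj : injected inj (t + 1) = injected inj t + ∑ v, (inj t v).length :=
    Finset.sum_range_succ _ _
  omega

end SubsetsRules

/-! ### Balanced allocation and the load of the threads. -/

/-- If the counters in `T` always differ by at most one, then the increases of the counters, each in
its own period, exceed the average increases in these periods by at most one each. -/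
theorem sum_increase_le_of_balanced {ι : Type*} (T : Finset ι) {m : ℕ} (hm : 0 < m)
    (hmT : m ≤ T.card) (c : ℕ → ι → ℕ) (j : ℕ) (s : ι → ℕ)
    (hmono : ∀ i ∈ T, ∀ i' ∈ T, c (s i) i' ≤ c j i')
    (hbal : ∀ t, ∀ i ∈ T, ∀ i' ∈ T, c t i ≤ c t i' + 1) :
    ∑ i ∈ T, ((c j i : ℝ) - c (s i) i) ≤
      ∑ i ∈ T, (∑ i' ∈ T, ((c j i' : ℝ) - c (s i) i')) / m + T.card := by
  have hT : (0 : ℝ) < T.card := by exact_mod_cast hm.trans_le hmT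
  -- Balance is needed only at the individual starting times; at the common end `j` the counters sum
  -- to the same as their averages, without loss.
  have h1 : ∀ i ∈ T, ((∑ i' ∈ T, (c (s i) i' : ℝ)) / T.card) ≤ c (s i) i + 1 := by
    intro i hi
    rw [div_le_iff₀ hT]
    calc ∑ i' ∈ T, (c (s i) i' : ℝ) ≤ ∑ _i' ∈ T, ((c (s i) i : ℝ) + 1) :=
          Finset.sum_le_sum fun i' hi' => by exact_mod_cast hbal (s i) i' hi' i hi
      _ = _ := by rw [Finset.sum_const, nsmul_eq_mul, mul_comm]
  have h2 : ∑ i ∈ T, (c j i : ℝ) = ∑ _i ∈ T, (∑ i' ∈ T, (c j i' : ℝ)) / T.card := by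
    rw [Finset.sum_const, nsmul_eq_mul, mul_div_cancel₀ _ hT.ne']
  calc ∑ i ∈ T, ((c j i : ℝ) - c (s i) i)
      ≤ ∑ i ∈ T, ((∑ i' ∈ T, (c j i' : ℝ)) / T.card -
          ((∑ i' ∈ T, (c (s i) i' : ℝ)) / T.card - 1)) := by
        rw [Finset.sum_sub_distrib, Finset.sum_sub_distrib, ← h2]
        exact sub_le_sub_left (Finset.sum_le_sum fun i hi => by linarith [h1 i hi]) _
    _ = ∑ i ∈ T, (∑ i' ∈ T, ((c j i' : ℝ) - c (s i) i')) / T.card + T.card := by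
        rw [Finset.cast_card, ← Finset.sum_add_distrib]
        refine Finset.sum_congr rfl fun i _ => ?_
        rw [Finset.sum_sub_distrib, sub_div]
        ring
    _ ≤ _ := by
        -- The total increases are nonnegative, so replacing the divisor `T.card` by the smaller `m`
        -- only enlarges the bound.
        gcongr with i hi
        refine Finset.sum_nonneg fun i' hi' => sub_nonneg.2 ?_
        exact_mod_cast hmono i hi i' hi'

namespace SubsetsRules

variable {n k : ℕ} {C : Type*} {R : SubsetsRules n k C}

/-- The threads in which two stations are both active. -/
def commonThreads (R : SubsetsRules n k C) (v w : Fin n) : Finset (Thread n k) :=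
  Finset.univ.filter fun i => v ∈ (R.A i).1 ∧ w ∈ (R.A i).1

theorem mem_commonThreads {v w : Fin n} {i : Thread n k} :
    i ∈ R.commonThreads v w ↔ v ∈ (R.A i).1 ∧ w ∈ (R.A i).1 := by
  simp [commonThreads]

/-- A packet may be addressed to the station it is injected into. The two-element set `P` containing
`v` and `w` covers the case `v = w` too, where there are more common threads and only the inequality
holds in general. -/
theorem choose_le_card_commonThreads (hk : 2 ≤ k) (hkn : k < n) (v w : Fin n) :
    (n - 2).choose (k - 2) ≤ (R.commonThreads v w).card := by
  obtain ⟨P, hP, hcard⟩ := Finset.exists_superset_card_eq (s := {v, w}) (n := 2)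
    Finset.card_le_two (by simp; omega)
  have hsub : Finset.powersetCard (k - 2) (Finset.univ \ P) ⊆
      (R.commonThreads v w).image fun i => (R.A i).1 \ P := by
    intro S hS
    obtain ⟨hSP, hSc⟩ := Finset.mem_powersetCard.1 hS
    have hdis : Disjoint S P := Finset.disjoint_of_subset_left hSP Finset.sdiff_disjoint
    have hc : (S ∪ P).card = k := by
      rw [Finset.card_union_of_disjoint hdis, hSc, hcard]
      omega
    refine Finset.mem_image.2 ⟨R.A.symm ⟨S ∪ P, hc⟩, mem_commonThreads.2 ?_, ?_⟩
    · rw [Equiv.apply_symm_apply]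
      exact ⟨Finset.mem_union_right _ (hP (by simp)), Finset.mem_union_right _ (hP (by simp))⟩
    · rw [Equiv.apply_symm_apply]
      exact Finset.union_sdiff_cancel_right hdis
  calc (n - 2).choose (k - 2) = (Finset.powersetCard (k - 2) (Finset.univ \ P)).card := by
        rw [Finset.card_powersetCard, Finset.card_univ_sdiff, hcard, Fintype.card_fin]
    _ ≤ _ := (Finset.card_le_card hsub).trans Finset.card_image_le

theorem sum_commonThreads {M : Type*} [AddCommMonoid M] (f : Fin n → Fin n → Thread n k → M) :
    ∑ v, ∑ w, ∑ i ∈ R.commonThreads v w, f v w i =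
      ∑ i, ∑ v ∈ (R.A i).1, ∑ w ∈ (R.A i).1, f v w i := by
  simp only [commonThreads, Finset.sum_filter]
  simp_rw [Finset.sum_comm (s := (Finset.univ : Finset (Fin n)))
    (t := (Finset.univ : Finset (Thread n k)))]
  refine Finset.sum_congr rfl fun i _ => ?_
  rw [← Finset.sum_filter_add_sum_filter_not Finset.univ (fun v => v ∈ (R.A i).1)]
  rw [Finset.sum_eq_zero (s := Finset.univ.filter fun v => v ∉ (R.A i).1), add_zero]
  · simp only [Finset.filter_univ_mem]
    refine Finset.sum_congr rfl fun v hv => ?_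
    simp only [hv, true_and, ← Finset.sum_filter, Finset.filter_univ_mem]
  · intro v hv
    simp [(Finset.mem_filter.1 hv).2]

theorem choose_mul_rate (hk : 2 ≤ k) (hkn : k < n) :
    (n.choose k : ℝ) * ((k * (k - 1) : ℝ) / (n * (n - 1))) = (n - 2).choose (k - 2) := by
  obtain ⟨k, rfl⟩ := Nat.exists_eq_add_of_le' hk
  obtain ⟨n, rfl⟩ := Nat.exists_eq_add_of_le' (hk.trans hkn.le)
  have h1 := Nat.add_one_mul_choose_eq (n + 1) (k + 1)
  have h2 := Nat.add_one_mul_choose_eq n k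
  have h3 : (n + 2) * (n + 1) * n.choose k = (n + 2).choose (k + 2) * ((k + 2) * (k + 1)) := by
    rw [mul_assoc, h2, ← mul_assoc, h1]
    ring
  have h4 : ((n : ℝ) + 2) * (n + 1) * n.choose k =
      (n + 2).choose (k + 2) * ((k + 2) * (k + 1)) := by exact_mod_cast h3
  rw [← mul_div_assoc, div_eq_iff]
  · push_cast
    linear_combination -h4
  · push_cast
    have : (0 : ℝ) ≤ n := n.cast_nonneg
    have : (0 : ℝ) < ((n : ℝ) + 2) * (n + 2 - 1) := mul_pos (by linarith) (by linarith)
    exact this.ne'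

theorem count_mono (hkn : k < n) (hk : 0 < k) (inj : Injection n C) (v w : Fin n)
    (i : Thread n k) : Monotone fun j => (R.states hkn inj (n.choose k * j) v).count w i :=
  monotone_nat_of_le_succ fun j => by
    obtain ⟨h, hmem, hh⟩ :=
      (consistent_states (R := R) hkn hk inj (n.choose k * j)).exists_holder i
    exact (phase_step hkn hk inj j hmem hh v).1 w

/-- The packets that the threads receive, each since the beginning of its own phase `s i`. -/
theorem sum_received_le (hk : 2 ≤ k) (hkn : k < n) {inj : Injection n C} {β : ℝ}
    (hinj : inj.OfType ((k * (k - 1) : ℝ) / (n * (n - 1))) β) (j : ℕ) (s : Thread n k → ℕ)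
    (hs : ∀ i, s i ≤ j) :
    ∑ i, ∑ v ∈ (R.A i).1, ∑ w, (((R.states hkn inj (n.choose k * j) v).count w i : ℝ) -
        (R.states hkn inj (n.choose k * s i) v).count w i) ≤
      ∑ i, ((j : ℝ) - s i) + n.choose k * β + n.choose k * k ^ 2 := by
  have hk0 : 0 < k := by omega
  set m := (n - 2).choose (k - 2) with hm
  have hm0 : 0 < m := Nat.choose_pos (by omega)
  have hm1 : (1 : ℝ) ≤ m := by exact_mod_cast hm0
  set c : Fin n → Fin n → ℕ → Thread n k → ℕ := fun v w t i =>
    (R.states hkn inj (n.choose k * t) v).count w i with hc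
  have hmono : ∀ v w i i', c v w (s i) i' ≤ c v w j i' := fun v w i i' =>
    count_mono hkn hk0 inj v w i' (hs i)
  have hzero : ∀ v w t i, ¬(v ∈ (R.A i).1 ∧ w ∈ (R.A i).1) → c v w t i = 0 := fun v w t i =>
    (consistent_states (R := R) hkn hk0 inj _).count_eq_zero v w i
  have hpair : ∀ v w, ∑ i ∈ R.commonThreads v w, ((c v w j i : ℝ) - c v w (s i) i) ≤
      ∑ i ∈ R.commonThreads v w, ((∑ i', ((c v w j i' : ℝ) - c v w (s i) i')) / m + 1) := by
    intro v w
    have h := sum_increase_le_of_balanced (R.commonThreads v w) hm0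
      (choose_le_card_commonThreads hk hkn v w) (c v w) j s (fun i _ i' _ => hmono v w i i')
      (fun t i hi i' hi' => (consistent_states (R := R) hkn hk0 inj _).balanced v w i i'
        (mem_commonThreads.1 hi).1 (mem_commonThreads.1 hi).2
        (mem_commonThreads.1 hi').1 (mem_commonThreads.1 hi').2)
    rw [Finset.cast_card, ← Finset.sum_add_distrib] at h
    refine h.trans_eq (Finset.sum_congr rfl fun i _ => ?_)
    rw [Finset.sum_subset (Finset.subset_univ (R.commonThreads v w)) fun i' _ hi' => ?_]
    have := mt mem_commonThreads.2 hi'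
    simp [hzero v w _ i' this]
  -- The pairs of $A_i$ receive together at most all packets injected since phase `s i`, which
  -- number at most $m(j-s_i)+\beta$; dividing by $m\ge1$ gives $(j-s_i)+\beta$. The $k^2$ is the
  -- loss of one for each pair.
  have hthread : ∀ i, ∑ v ∈ (R.A i).1, ∑ w ∈ (R.A i).1,
      ((∑ i', ((c v w j i' : ℝ) - c v w (s i) i')) / m + 1) ≤ ((j : ℝ) - s i) + β + k ^ 2 := by
    intro i
    have h1 : ∑ v ∈ (R.A i).1, ∑ w ∈ (R.A i).1, (∑ i', ((c v w j i' : ℝ) - c v w (s i) i')) ≤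
        ∑ v, ∑ w, ∑ i', ((c v w j i' : ℝ) - c v w (s i) i') := by
      have hnn : ∀ v w, 0 ≤ ∑ i', ((c v w j i' : ℝ) - c v w (s i) i') := fun v w =>
        Finset.sum_nonneg fun i' _ => sub_nonneg.2 (by exact_mod_cast hmono v w i i')
      refine (Finset.sum_le_sum fun v _ => Finset.sum_le_sum_of_subset_of_nonneg
        (Finset.subset_univ _) fun w _ _ => hnn v w).trans ?_
      exact Finset.sum_le_sum_of_subset_of_nonneg (Finset.subset_univ _)
        fun v _ _ => Finset.sum_nonneg fun w _ => hnn v w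
    have h2 : ∑ v, ∑ w, ∑ i', ((c v w j i' : ℝ) - c v w (s i) i') =
        (injected inj (n.choose k * j) : ℝ) - injected inj (n.choose k * s i) := by
      rw [← sum_count_phase (R := R) hkn hk0 inj j, ← sum_count_phase (R := R) hkn hk0 inj (s i)]
      push_cast
      simp only [Finset.sum_sub_distrib, hc]
    have h3 := injected_sub_le hinj (Nat.mul_le_mul_left (n.choose k) (hs i))
    have h4 : ((k * (k - 1) : ℝ) / (n * (n - 1))) *
        (((n.choose k * j : ℕ) : ℝ) - (n.choose k * s i : ℕ)) = m * ((j : ℝ) - s i) := by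
      rw [hm, ← choose_mul_rate hk hkn]
      push_cast
      ring
    have hβ : 0 ≤ β := by linarith [hinj.2.2.1]
    simp only [Finset.sum_add_distrib, Finset.sum_const, (R.A i).2, ← Finset.sum_div]
    have h5 : (∑ v ∈ (R.A i).1, ∑ w ∈ (R.A i).1, (∑ i', ((c v w j i' : ℝ) - c v w (s i) i'))) / m ≤
        ((j : ℝ) - s i) + β := by
      rw [div_le_iff₀ (by linarith)]
      nlinarith
    simp only [nsmul_eq_mul, mul_one]
    rw [sq]
    linarith
  calc ∑ i, ∑ v ∈ (R.A i).1, ∑ w, ((c v w j i : ℝ) - c v w (s i) i)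
      -- Summing by pairs allows the balance of each pair to be used; afterwards the sum is turned
      -- back to one by threads, each of which has a single period.
      = ∑ v, ∑ w, ∑ i ∈ R.commonThreads v w, ((c v w j i : ℝ) - c v w (s i) i) := by
        rw [sum_commonThreads]
        refine Finset.sum_congr rfl fun i _ => Finset.sum_congr rfl fun v _ => ?_
        symm
        refine Finset.sum_subset (Finset.subset_univ _) fun w _ hw => ?_
        simp [hzero v w _ i fun h => hw h.2]
    _ ≤ ∑ v, ∑ w, ∑ i ∈ R.commonThreads v w,
          ((∑ i', ((c v w j i' : ℝ) - c v w (s i) i')) / m + 1) :=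
        Finset.sum_le_sum fun v _ => Finset.sum_le_sum fun w _ => hpair v w
    _ ≤ ∑ i, (((j : ℝ) - s i) + β + k ^ 2) := by
        rw [sum_commonThreads]
        exact Finset.sum_le_sum fun i _ => hthread i
    _ = _ := by
        simp [Finset.sum_add_distrib]

/-! ### The bound on the number of queued packets. -/

theorem sum_threadQueue_le (hk : 2 ≤ k) (hkn : k < n) {inj : Injection n C} {β : ℝ}
    (hinj : inj.OfType ((k * (k - 1) : ℝ) / (n * (n - 1))) β) (j : ℕ) :
    (∑ i, ∑ v ∈ (R.A i).1,
        ((R.states hkn inj (n.choose k * j) v).threadQueue i).length : ℕ) ≤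
      (n.choose k : ℝ) * (2 * k ^ 2 + β) := by
  have hrun : ∀ i, ∃ s ≤ j, ∑ v ∈ (R.A i).1,
        ((R.states hkn inj (n.choose k * j) v).threadQueue i).length +
      ∑ v ∈ (R.A i).1, ∑ w, (R.states hkn inj (n.choose k * s) v).count w i + j ≤
      k ^ 2 + ∑ v ∈ (R.A i).1, ∑ w, (R.states hkn inj (n.choose k * j) v).count w i + s := by
    intro i
    have hcard := (R.A i).2
    obtain ⟨v₀, hv₀⟩ : (R.A i).1.Nonempty := Finset.card_pos.1 (by omega)
    have := (moveBigToFrontRun hkn (by omega) inj i hv₀).exists_sum_le (by omega) j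
    rwa [hcard] at this
  choose s hs hle using hrun
  have h1 := sum_received_le (R := R) hk hkn hinj j s hs
  have h2 : ∀ i, ((∑ v ∈ (R.A i).1,
        ((R.states hkn inj (n.choose k * j) v).threadQueue i).length : ℕ) : ℝ) ≤
      k ^ 2 + ∑ v ∈ (R.A i).1, ∑ w, (((R.states hkn inj (n.choose k * j) v).count w i : ℝ) -
        (R.states hkn inj (n.choose k * s i) v).count w i) - ((j : ℝ) - s i) := by
    intro i
    have h : ((_ : ℕ) : ℝ) ≤ ((_ : ℕ) : ℝ) := Nat.cast_le.2 (hle i)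
    simp only [Finset.sum_sub_distrib]
    push_cast at h ⊢
    linarith
  -- On summation the rounds $j-s_i$ gained by the threads cancel those in `h1`; a $k^2$ per thread
  -- comes from each of the two estimates.
  have h3 := Finset.sum_le_sum fun i (_ : i ∈ Finset.univ) => h2 i
  rw [Finset.sum_sub_distrib, Finset.sum_add_distrib, Finset.sum_const, Finset.card_univ,
    Fintype.card_fin, nsmul_eq_mul] at h3
  rw [Nat.cast_sum]
  linarith

theorem queueSize_le_bound (hk : 2 ≤ k) (hkn : k < n) {inj : Injection n C} {β : ℝ}
    (hinj : inj.OfType ((k * (k - 1) : ℝ) / (n * (n - 1))) β) (t : ℕ) :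
    ((kSubsets hkn R).queueSize inj t : ℝ) ≤ 2 * (n.choose k : ℝ) * ((n : ℝ) ^ 2 + β) := by
  have hγ : 0 < n.choose k := Nat.choose_pos hkn.le
  have hr : t % n.choose k < n.choose k := Nat.mod_lt _ hγ
  have h1 := queueSize_le (R := R) hkn (by omega) inj (t / n.choose k) hr
  rw [Nat.div_add_mod] at h1
  have h2 := sum_threadQueue_le (R := R) hk hkn hinj (t / n.choose k)
  have hdm := Nat.div_add_mod t (n.choose k)
  have h3 := injected_sub_le hinj (s := n.choose k * (t / n.choose k)) (t := t + 1) (by omega)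
  obtain ⟨hρ0, hρ1, hβ, -⟩ := hinj
  have h4 : ((t + 1 : ℕ) : ℝ) - (n.choose k * (t / n.choose k) : ℕ) ≤ n.choose k := by
    rw [sub_le_iff_le_add]
    exact_mod_cast (by omega : t + 1 ≤ n.choose k + n.choose k * (t / n.choose k))
  have h4' : (0 : ℝ) ≤ ((t + 1 : ℕ) : ℝ) - (n.choose k * (t / n.choose k) : ℕ) := by
    rw [sub_nonneg]
    exact_mod_cast (by omega : n.choose k * (t / n.choose k) ≤ t + 1)
  -- The current phase adds at most $\rho\gamma+\beta\le\gamma+\beta$ packets. The total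
  -- $\gamma(2k^2+\beta)+\gamma+\beta$ is within the claim because $k^2+1\le n^2$ and
  -- $\beta\le\gamma\beta$.
  have h5 := mul_le_mul hρ1 h4 h4' zero_le_one
  have h6 : ((_ : ℕ) : ℝ) ≤ ((_ : ℕ) : ℝ) := Nat.cast_le.2 h1
  rw [Nat.cast_add, Nat.cast_add] at h6
  have hγ1 : (1 : ℝ) ≤ n.choose k := by exact_mod_cast hγ
  have hkn' : (k : ℝ) + 1 ≤ n := by exact_mod_cast hkn
  have hk0 : (0 : ℝ) ≤ k := k.cast_nonneg
  have hsq : (k : ℝ) ^ 2 + 1 ≤ (n : ℝ) ^ 2 := by nlinarith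
  have h7 : β ≤ n.choose k * β := le_mul_of_one_le_left (by linarith) hγ1
  have h8 : (n.choose k : ℝ) * (k ^ 2 + 1) ≤ n.choose k * n ^ 2 :=
    mul_le_mul_of_nonneg_left hsq (by linarith)
  linarith

end SubsetsRules

theorem mainTheorem7 {C : Type*} (n k : ℕ) (hk : 2 ≤ k) (hkn : k < n)
    (R : SubsetsRules n k C) :
    (kSubsets hkn R).EnergyOblivious k ∧
    (kSubsets hkn R).RoutesDirectly ∧
    (kSubsets hkn R).Stable ((k * (k - 1) : ℝ) / (n * (n - 1))) ∧
    ∀ (β : ℝ) (inj : Injection n C),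
      inj.OfType ((k * (k - 1) : ℝ) / (n * (n - 1))) β →
      ∀ t : ℕ, ((kSubsets hkn R).queueSize inj t : ℝ) ≤ 2 * (n.choose k : ℝ) * ((n : ℝ) ^ 2 + β) :=
  ⟨SubsetsRules.energyOblivious hkn, SubsetsRules.routesDirectly hkn (by omega),
    fun _ _ => ⟨_, fun _ hinj => SubsetsRules.queueSize_le_bound hk hkn hinj⟩,
    fun _ _ hinj => SubsetsRules.queueSize_le_bound hk hkn hinj⟩
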